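/- Let $d \ge 2$ and let $X$ be a homogeneous Poisson process on $\mathbb{R}^d$ of intensity $\rho > 0$. For $x \in X$ let $d_1(x)$ be the Euclidean distance from $x$ to its nearest neighbour in $X \setminus \{x\}$. For $\alpha \ge 0$, the model $\mathrm{GN}_1(d,\alpha)$ is the undirected graph with vertex set $X$ in which every $x \in X$ is joined by an edge to all points $y \in X\setminus\{x\}$ with $|x-y| \le \alpha\, d_1(x)$ (so $x$ and $y$ are adjacent if and only if $|x-y| \le \alpha\max(d_1(x),d_1(y))$). Let $U$ be the event that this graph has an infinite connected component, and let $$\alpha_c(d) = \inf\{\alpha \ge 0 : \mathbb{P}(U) > 0\}, \qquad \inf\emptyset = \infty.$$ Then $\alpha_c(d) < \infty$; that is, there is a constant $A < \infty$ depending only on $d$ such that, for every $\rho>0$ and every such Poisson process, $\inf\{\alpha \ge 0 : \mathbb{P}(U) > 0\} \le A$. -/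

import Mathlib

open MeasureTheory ProbabilityTheory
open scoped NNReal ENNReal

/-- `X` is a homogeneous Poisson process of intensity `ρ` on `ℝ^d`, defined on the probability
space `(Ω, P)`: a random locally finite set of points, such that the number of points in a bounded
Borel set `B` is a Poisson random variable with mean `ρ * vol B`, and the numbers of points in
finitely many pairwise disjoint bounded Borel sets are independent. (The cardinality `Set.ncard` is
only ever taken of a finite set, by `locallyFinite`.) -/
structure IsPoissonProcess {Ω : Type*} [MeasurableSpace Ω] (P : Measure Ω) {d : ℕ} (ρ : ℝ≥0)
    (X : Ω → Set (EuclideanSpace ℝ (Fin d))) : Prop where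
  locallyFinite : ∀ (ω : Ω) (B : Set (EuclideanSpace ℝ (Fin d))),
    Bornology.IsBounded B → (X ω ∩ B).Finite
  measurable_count : ∀ B : Set (EuclideanSpace ℝ (Fin d)), MeasurableSet B →
    Bornology.IsBounded B → Measurable fun ω => (X ω ∩ B).ncard
  law_count : ∀ B : Set (EuclideanSpace ℝ (Fin d)), MeasurableSet B →
    Bornology.IsBounded B →
      P.map (fun ω => (X ω ∩ B).ncard) = poissonMeasure (ρ * (volume B).toNNReal)
  indep_count : ∀ (n : ℕ) (B : Fin n → Set (EuclideanSpace ℝ (Fin d))),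
    (∀ i, MeasurableSet (B i)) → (∀ i, Bornology.IsBounded (B i)) →
    Pairwise (Function.onFun Disjoint B) →
      iIndepFun (fun i ω => (X ω ∩ B i).ncard) P

/-- `d₁(x)`: the distance from `x` to its nearest neighbour in the configuration `S`, that is, to
the set of the points of `S` other than `x`. -/
noncomputable def nnDist {d : ℕ} (S : Set (EuclideanSpace ℝ (Fin d)))
    (x : EuclideanSpace ℝ (Fin d)) : ℝ :=
  Metric.infDist x (S \ {x})

/-- The graph of the model `GN₁(d, α)` on the configuration `S`: every point `x` of `S` is joined by
an (undirected) edge to all other points `y` of `S` with `|x - y| ≤ α d₁(x)`. -/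
def gnOneGraph {d : ℕ} (α : ℝ≥0) (S : Set (EuclideanSpace ℝ (Fin d))) : SimpleGraph S :=
  SimpleGraph.fromRel fun x y : S =>
    dist (x : EuclideanSpace ℝ (Fin d)) (y : EuclideanSpace ℝ (Fin d)) ≤ α * nnDist S x

/-- The graph of `GN₁(d, α)` on the configuration `S` has an infinite connected component. -/
def Percolates {d : ℕ} (α : ℝ≥0) (S : Set (EuclideanSpace ℝ (Fin d))) : Prop :=
  ∃ C : (gnOneGraph α S).ConnectedComponent, C.supp.Infinite

/-- The critical value `inf {α ≥ 0 : P(U) > 0}` of the model `GN₁(d, α)` on the random configuration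
`X`, where `U` is the event that there is an infinite component. It is `∞` if there is no such
`α`. -/
noncomputable def criticalValue {Ω : Type*} [MeasurableSpace Ω] (P : Measure Ω) {d : ℕ}
    (X : Ω → Set (EuclideanSpace ℝ (Fin d))) : ℝ≥0∞ :=
  sInf {a : ℝ≥0∞ | ∃ α : ℝ≥0, a = α ∧ 0 < P {ω | Percolates α (X ω)}}

/-! Choose the length `ℓ` with `ρ * ℓ ^ d = 1` and look at a planar array of cells of side `3 ℓ`. A
cell whose only point lies in its central cube of side `ℓ` forces `d₁ ≥ ℓ` at that point. These
events are independent, with probability at least some `q > 0` depending only on `d`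
(`le_measure_lonelyEvent`). Grouping `M` cells in a row into a site makes sites open with
probability at least `199 / 200`, and the lonely points of adjacent open sites are joined once `α =
6 M d` (`percolates_of_forall_blockGood`).

It remains to percolate on a quadrant of highly probable independent sites. In place of a contour
argument there is a renormalisation: a bad block contains two bad subblocks, so the bad
probabilities satisfy `p (k + 1) ≤ 81 * p k ^ 2` and have a sum below 1 (`measure_blockBad_le`).
With positive probability all blocks at the origin are good, and then a cluster of open sites
reaches arbitrarily far (`exists_rel_far_of_forall_blockGood`). -/

/-- Hierarchical goodness: a block of level `k + 1` is made of `3 × 3` blocks of level `k`, and it is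
good if at most one of these is not good. The blocks of level `0` are the sites. -/
def blockGood (G : ℕ → ℕ → Prop) : ℕ → ℕ → ℕ → Prop
  | 0, a, b => G a b
  | k + 1, a, b => ∃ p : Fin 3 × Fin 3, ∀ q : Fin 3 × Fin 3, q ≠ p →
      blockGood G k (3 * a + q.1) (3 * b + q.2)

open Classical in
/-- A good site of the block of level `k` with index `(a, b)`, provided that the block is good. -/
noncomputable def blockRep (G : ℕ → ℕ → Prop) : ℕ → ℕ → ℕ → ℕ × ℕ
  | 0, a, b => (a, b)
  | k + 1, a, b =>
      if blockGood G k (3 * a) (3 * b) then blockRep G k (3 * a) (3 * b)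
      else blockRep G k (3 * a + 1) (3 * b)

/-! ### Connectivity inside good blocks -/

section Deterministic

variable {G : ℕ → ℕ → Prop}

theorem blockGood_succ {k a b : ℕ} : blockGood G (k + 1) a b ↔
    ∃ p : Fin 3 × Fin 3, ∀ q : Fin 3 × Fin 3, q ≠ p →
      blockGood G k (3 * a + q.1) (3 * b + q.2) := Iff.rfl

/-- At most one subblock fails, so two candidates suffice for the choice. -/
theorem exists_blockRep_succ_eq {k a b : ℕ} (h : blockGood G (k + 1) a b) :
    ∃ q : Fin 3 × Fin 3, blockGood G k (3 * a + q.1) (3 * b + q.2) ∧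
      blockRep G (k + 1) a b = blockRep G k (3 * a + q.1) (3 * b + q.2) := by
  by_cases h0 : blockGood G k (3 * a) (3 * b)
  · exact ⟨(0, 0), by simpa using h0, by simp [blockRep, h0]⟩
  · obtain ⟨p, hp⟩ := h
    have hp0 : p = (0, 0) := by
      by_contra hne
      exact h0 (by simpa using hp (0, 0) (Ne.symm hne))
    refine ⟨(1, 0), hp _ (by rw [hp0]; decide), by simp [blockRep, h0]⟩

theorem blockRep_div (k a b : ℕ) : (blockRep G k a b).1 / 3 ^ k = a := by
  induction k generalizing a b with
  | zero => simp [blockRep]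
  | succ k ih =>
    rw [pow_succ, ← Nat.div_div_eq_div_mul]
    unfold blockRep
    split_ifs
    · rw [ih]; omega
    · rw [ih]; omega

theorem blockRep_good {k a b : ℕ} (h : blockGood G k a b) :
    G (blockRep G k a b).1 (blockRep G k a b).2 := by
  induction k generalizing a b with
  | zero => exact h
  | succ k ih =>
    obtain ⟨q, hq, e⟩ := exists_blockRep_succ_eq h
    rw [e]
    exact ih hq

theorem equivalence_line {V : Type*} {r : V → V → Prop} (hr : Equivalence r) {f : Fin 3 → V}
    (h0 : r (f 0) (f 1)) (h1 : r (f 1) (f 2)) (i j : Fin 3) : r (f i) (f j) := by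
  have h2 := hr.trans h0 h1
  fin_cases i <;> fin_cases j <;>
    first
    | exact hr.refl _
    | exact h0
    | exact h1
    | exact h2
    | exact hr.symm h0
    | exact hr.symm h1
    | exact hr.symm h2

/-- A `3 × 3` grid stays connected when one place is removed: each remaining place lies on a full
row or a full column that avoids it, and these rows and columns cross. -/
theorem equivalence_grid {V : Type*} {r : V → V → Prop} (hr : Equivalence r)
    {f : Fin 3 → Fin 3 → V} {p : Fin 3 × Fin 3}
    (hrow : ∀ j, j ≠ p.2 → ∀ i i', r (f i j) (f i' j))
    (hcol : ∀ i, i ≠ p.1 → ∀ j j', r (f i j) (f i j'))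
    {q q' : Fin 3 × Fin 3} (hq : q ≠ p) (hq' : q' ≠ p) : r (f q.1 q.2) (f q'.1 q'.2) := by
  have hex : ∀ x : Fin 3, ∃ y, y ≠ x := by decide
  obtain ⟨i, hi⟩ := hex p.1
  obtain ⟨j, hj⟩ := hex p.2
  have key : ∀ s : Fin 3 × Fin 3, s ≠ p → r (f s.1 s.2) (f i j) := by
    intro s hs
    by_cases h : s.1 = p.1
    · have h2 : s.2 ≠ p.2 := fun h2 => hs (Prod.ext h h2)
      exact hr.trans (hrow _ h2 _ i) (hcol i hi _ _)
    · exact hr.trans (hcol _ h _ j) (hrow j hj _ _)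
  exact hr.trans (key q hq) (hr.symm (key q' hq'))

variable {V : Type*} {r : V → V → Prop} {f : ℕ → ℕ → V}

theorem blockRep_rel_of_sub (hr : Equivalence r) {k a b : ℕ}
    (hx : ∀ a b, blockGood G k a b → blockGood G k (a + 1) b →
      r (f.uncurry (blockRep G k a b)) (f.uncurry (blockRep G k (a + 1) b)))
    (hy : ∀ a b, blockGood G k a b → blockGood G k a (b + 1) →
      r (f.uncurry (blockRep G k a b)) (f.uncurry (blockRep G k a (b + 1))))
    (h : blockGood G (k + 1) a b) (q : Fin 3 × Fin 3)
    (hq : blockGood G k (3 * a + q.1) (3 * b + q.2)) :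
    r (f.uncurry (blockRep G (k + 1) a b))
      (f.uncurry (blockRep G k (3 * a + q.1) (3 * b + q.2))) := by
  obtain ⟨q', hq', e⟩ := exists_blockRep_succ_eq h
  rw [e]
  obtain ⟨p, hp⟩ := h
  set F : Fin 3 → Fin 3 → V := fun i j =>
    f.uncurry (blockRep G k (3 * a + i) (3 * b + j)) with hF
  have hrow : ∀ j, j ≠ p.2 → ∀ i i', r (F i j) (F i' j) := by
    intro j hj i i'
    have hg : ∀ i : Fin 3, blockGood G k (3 * a + i) (3 * b + j) :=
      fun i => hp (i, j) (fun h => hj (congrArg Prod.snd h))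
    exact equivalence_line hr (f := fun i => F i j)
      (hx _ _ (hg 0) (hg 1)) (hx _ _ (hg 1) (hg 2)) i i'
  have hcol : ∀ i, i ≠ p.1 → ∀ j j', r (F i j) (F i j') := by
    intro i hi j j'
    have hg : ∀ j : Fin 3, blockGood G k (3 * a + i) (3 * b + j) :=
      fun j => hp (i, j) (fun h => hi (congrArg Prod.fst h))
    exact equivalence_line hr (f := fun j => F i j)
      (hy _ _ (hg 0) (hg 1)) (hy _ _ (hg 1) (hg 2)) j j'
  by_cases hqq : q = q'
  · subst hqq; exact hr.refl _
  -- if the exceptional subblock is good as well, it is linked to the others by one of its neighbours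
  by_cases hall : blockGood G k (3 * a + p.1) (3 * b + p.2)
  · have hg : ∀ i j : Fin 3, blockGood G k (3 * a + i) (3 * b + j) := by
      intro i j
      by_cases hij : (i, j) = p
      · rw [← hij] at hall; exact hall
      · exact hp (i, j) hij
    have h1 : r (F q'.1 q'.2) (F q.1 q'.2) :=
      equivalence_line hr (f := fun i => F i q'.2)
        (hx _ _ (hg 0 _) (hg 1 _)) (hx _ _ (hg 1 _) (hg 2 _)) _ _
    have h2 : r (F q.1 q'.2) (F q.1 q.2) :=
      equivalence_line hr (f := fun j => F q.1 j)
        (hy _ _ (hg _ 0) (hg _ 1)) (hy _ _ (hg _ 1) (hg _ 2)) _ _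
    exact hr.trans h1 h2
  · exact equivalence_grid hr (f := F) hrow hcol (fun h => hall (h ▸ hq')) (fun h => hall (h ▸ hq))

/-- Three pairs of subblocks face each other across the common side, and each block spoils at most
one pair. The remaining pair is linked by induction, and inside each block it is linked to the
representative. -/
theorem blockRep_rel_neighbours (hr : Equivalence r)
    (hx : ∀ a b, G a b → G (a + 1) b → r (f a b) (f (a + 1) b))
    (hy : ∀ a b, G a b → G a (b + 1) → r (f a b) (f a (b + 1))) (k : ℕ) :
    (∀ a b, blockGood G k a b → blockGood G k (a + 1) b →
      r (f.uncurry (blockRep G k a b)) (f.uncurry (blockRep G k (a + 1) b))) ∧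
    (∀ a b, blockGood G k a b → blockGood G k a (b + 1) →
      r (f.uncurry (blockRep G k a b)) (f.uncurry (blockRep G k a (b + 1)))) := by
  have hex : ∀ x y : Fin 3, ∃ z, z ≠ x ∧ z ≠ y := by decide
  induction k with
  | zero => exact ⟨hx, hy⟩
  | succ k ih =>
    obtain ⟨ihx, ihy⟩ := ih
    constructor
    · intro a b h h'
      obtain ⟨p, hp⟩ := blockGood_succ.1 h
      obtain ⟨p', hp'⟩ := blockGood_succ.1 h'
      obtain ⟨j, hj, hj'⟩ := hex p.2 p'.2
      have g := hp (2, j) (fun h => hj (congrArg Prod.snd h))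
      have g' := hp' (0, j) (fun h => hj' (congrArg Prod.snd h))
      exact hr.trans (blockRep_rel_of_sub hr ihx ihy h _ g)
        (hr.trans (ihx _ _ g g') (hr.symm (blockRep_rel_of_sub hr ihx ihy h' _ g')))
    · intro a b h h'
      obtain ⟨p, hp⟩ := blockGood_succ.1 h
      obtain ⟨p', hp'⟩ := blockGood_succ.1 h'
      obtain ⟨i, hi, hi'⟩ := hex p.1 p'.1
      have g := hp (i, 2) (fun h => hi (congrArg Prod.fst h))
      have g' := hp' (i, 0) (fun h => hi' (congrArg Prod.fst h))
      exact hr.trans (blockRep_rel_of_sub hr ihx ihy h _ g)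
        (hr.trans (ihy _ _ g g') (hr.symm (blockRep_rel_of_sub hr ihx ihy h' _ g')))

theorem exists_rel_far_of_forall_blockGood (hr : Equivalence r)
    (hx : ∀ a b, G a b → G (a + 1) b → r (f a b) (f (a + 1) b))
    (hy : ∀ a b, G a b → G a (b + 1) → r (f a b) (f a (b + 1)))
    (hG : ∀ k, blockGood G k 0 0) (n : ℕ) :
    ∃ a b, n ≤ a ∧ G a b ∧ r (f 0 0) (f a b) := by
  have hsub : ∀ (k : ℕ) (q : Fin 3 × Fin 3), blockGood G k (3 * 0 + q.1) (3 * 0 + q.2) →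
      r (f.uncurry (blockRep G (k + 1) 0 0))
        (f.uncurry (blockRep G k (3 * 0 + q.1) (3 * 0 + q.2))) := fun k q hq =>
    blockRep_rel_of_sub hr (blockRep_rel_neighbours hr hx hy k).1
      (blockRep_rel_neighbours hr hx hy k).2 (hG (k + 1)) q hq
  have hroot : ∀ k, r (f 0 0) (f.uncurry (blockRep G k 0 0)) := by
    intro k
    induction k with
    | zero => exact hr.refl _
    | succ k ih =>
      exact hr.trans ih (hr.symm (hsub k (0, 0) (by simpa using hG k)))
  -- A good subblock outside column `0` has all its sites at first coordinate at least `3 ^ n`.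
  obtain ⟨p, hp⟩ := blockGood_succ.1 (hG (n + 1))
  obtain ⟨i, hi, hi0⟩ : ∃ i : Fin 3, i ≠ p.1 ∧ i ≠ 0 :=
    (by decide : ∀ x y : Fin 3, ∃ z, z ≠ x ∧ z ≠ y) _ _
  have g := hp (i, 0) (fun h => hi (congrArg Prod.fst h))
  refine ⟨_, _, ?_, blockRep_good g, hr.trans (hroot (n + 1)) (hsub n (i, 0) g)⟩
  have hdiv := blockRep_div (G := G) n (3 * 0 + i) (3 * 0 + (0 : Fin 3))
  have hpos : 1 ≤ (i : ℕ) := Nat.one_le_iff_ne_zero.2 (fun h => hi0 (Fin.ext h))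
  have : 3 ^ n ≤ (blockRep G n (3 * 0 + i) (3 * 0 + (0 : Fin 3))).1 := by
    by_contra! hlt
    rw [Nat.div_eq_of_lt hlt] at hdiv
    omega
  exact (Nat.lt_pow_self (by norm_num)).le.trans this

end Deterministic

/-! ### Probability that blocks are good -/

/-- The site `(a, b)` is open if one of the `M` cells `(M a, b), …, (M a + M - 1, b)` is. -/
def siteOpen {Ω : Type*} (E : ℕ × ℕ → Set Ω) (M : ℕ) (ω : Ω) (a b : ℕ) : Prop :=
  ∃ i < M, ω ∈ E (M * a + i, b)

/-- The cells of the block of level `k` with index `(a, b)`. -/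
def blockCells (M k a b : ℕ) : Set (ℕ × ℕ) :=
  {c | c.1 / (M * 3 ^ k) = a ∧ c.2 / 3 ^ k = b}

section Probability

variable {Ω : Type*} {E : ℕ × ℕ → Set Ω} {M : ℕ}

theorem blockCells_succ_subset (k a b : ℕ) (q : Fin 3 × Fin 3) :
    blockCells M k (3 * a + q.1) (3 * b + q.2) ⊆ blockCells M (k + 1) a b := by
  rintro c ⟨h1, h2⟩
  constructor
  · rw [pow_succ, ← mul_assoc, ← Nat.div_div_eq_div_mul, h1]
    have := q.1.2
    omega
  · rw [pow_succ, ← Nat.div_div_eq_div_mul, h2]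
    have := q.2.2
    omega

theorem disjoint_blockCells {k a b a' b' : ℕ} (h : (a, b) ≠ (a', b')) :
    Disjoint (blockCells M k a b) (blockCells M k a' b') := by
  refine Set.disjoint_left.2 ?_
  rintro c ⟨rfl, rfl⟩ ⟨h1, h2⟩
  exact h (by rw [h1, h2])

/-- The σ-algebra of the block's own cells is what makes distinct blocks of one level independent.
-/
theorem measurableSet_blockGood (k a b : ℕ) :
    MeasurableSet[⨆ c ∈ blockCells M k a b, MeasurableSpace.generateFrom {E c}]
      {ω | blockGood (siteOpen E M ω) k a b} := by
  induction k generalizing a b with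
  | zero =>
    have : {ω | blockGood (siteOpen E M ω) 0 a b} = ⋃ i ∈ Finset.range M, E (M * a + i, b) := by
      ext ω; simp [blockGood, siteOpen]
    rw [this]
    refine Finset.measurableSet_biUnion _ fun i hi => ?_
    have hi : i < M := Finset.mem_range.1 hi
    have hmem : (M * a + i, b) ∈ blockCells M 0 a b := by
      refine ⟨?_, by simp⟩
      simp only [pow_zero, mul_one]
      rw [Nat.mul_add_div (by omega), Nat.div_eq_of_lt hi, add_zero]
    exact le_iSup₂ (f := fun c (_ : c ∈ blockCells M 0 a b) => MeasurableSpace.generateFrom {E c})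
      _ hmem _ (MeasurableSpace.measurableSet_generateFrom rfl)
  | succ k ih =>
    have : {ω | blockGood (siteOpen E M ω) (k + 1) a b} =
        ⋃ p : Fin 3 × Fin 3, ⋂ q : Fin 3 × Fin 3, ⋂ _ : q ≠ p,
          {ω | blockGood (siteOpen E M ω) k (3 * a + q.1) (3 * b + q.2)} := by
      ext ω; simp [blockGood_succ]
    rw [this]
    refine MeasurableSet.iUnion fun p => MeasurableSet.iInter fun q => MeasurableSet.iInter fun _ =>
      ?_
    exact biSup_mono (f := fun c => MeasurableSpace.generateFrom {E c})
      (fun c hc => blockCells_succ_subset k a b q hc) _ (ih _ _)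

variable [MeasurableSpace Ω] {P : Measure Ω}

theorem measure_blockBad_inter (hE : ∀ c, MeasurableSet (E c)) (hind : iIndepSet E P)
    {k a b a' b' : ℕ} (h : (a, b) ≠ (a', b')) :
    P ({ω | ¬ blockGood (siteOpen E M ω) k a b} ∩ {ω | ¬ blockGood (siteOpen E M ω) k a' b'}) =
      P {ω | ¬ blockGood (siteOpen E M ω) k a b} *
        P {ω | ¬ blockGood (siteOpen E M ω) k a' b'} := by
  have hI := indep_iSup_of_disjoint
    (fun c => MeasurableSpace.generateFrom_le (by rintro _ rfl; exact hE c))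
    ((iIndepSet_iff_iIndep E P).1 hind) (disjoint_blockCells (M := M) (k := k) h)
  exact (Indep_iff _ _ _).1 hI _ _ (measurableSet_blockGood k a b).compl
    (measurableSet_blockGood k a' b').compl

theorem measure_siteClosed_le [IsProbabilityMeasure P] (hE : ∀ c, MeasurableSet (E c))
    (hind : iIndepSet E P) {q : ℝ≥0∞} (hq : ∀ c, q ≤ P (E c)) (a b : ℕ) : P {ω | ¬ siteOpen E M ω a b} ≤ (1 - q) ^ M := by
  have hinj : Function.Injective fun i : ℕ => (M * a + i, b) := fun i j h => by
    simpa using h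
  have : {ω | ¬ siteOpen E M ω a b} =
      ⋂ c ∈ (Finset.range M).map ⟨fun i => (M * a + i, b), hinj⟩, (E c)ᶜ := by
    ext ω; simp [siteOpen]
  rw [this, ((iIndepSet_iff_iIndep E P).1 hind).meas_biInter
    (fun c _ => MeasurableSet.compl (m := MeasurableSpace.generateFrom {E c})
      (MeasurableSpace.measurableSet_generateFrom rfl))]
  refine (Finset.prod_le_pow_card _ _ (1 - q) fun c _ => ?_).trans (by simp)
  rw [prob_compl_eq_one_sub (hE c)]
  exact tsub_le_tsub_left (hq c) 1

/-- Two distinct bad subblocks are independent and there are at most 81 ordered pairs; the induction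
closes because `81 / 200 ≤ 1 / 2`. -/
theorem measure_blockBad_le (hE : ∀ c, MeasurableSet (E c)) (hind : iIndepSet E P)
    (h0 : ∀ a b, P {ω | ¬ siteOpen E M ω a b} ≤ ENNReal.ofReal (1 / 200)) (k a b : ℕ) :
    P {ω | ¬ blockGood (siteOpen E M ω) k a b} ≤ ENNReal.ofReal (1 / 200 * (1 / 2) ^ k) := by
  induction k generalizing a b with
  | zero =>
    rw [pow_zero, mul_one]
    exact h0 a b
  | succ k ih =>
    set B : Fin 3 × Fin 3 → Set Ω := fun q =>
      {ω | ¬ blockGood (siteOpen E M ω) k (3 * a + q.1) (3 * b + q.2)} with hB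
    set S : Finset ((Fin 3 × Fin 3) × (Fin 3 × Fin 3)) := Finset.univ.filter fun s => s.1 ≠ s.2
    have hcard : S.card ≤ 81 := (Finset.card_le_univ S).trans (by simp)
    have hsub : {ω | ¬ blockGood (siteOpen E M ω) (k + 1) a b} ⊆ ⋃ s ∈ S, B s.1 ∩ B s.2 := by
      intro ω hω
      have hω : ∀ p : Fin 3 × Fin 3, ∃ q, q ≠ p ∧ ω ∈ B q := by
        simpa [blockGood_succ, hB] using hω
      -- The start `(0, 0)` is arbitrary: it yields one bad subblock, which taken as the exception
      -- yields a second.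
      obtain ⟨q, -, hq⟩ := hω (0, 0)
      obtain ⟨q', hne, hq'⟩ := hω q
      exact Set.mem_biUnion (x := (q', q)) (by simp [S, hne]) ⟨hq', hq⟩
    have hpair : ∀ s ∈ S, P (B s.1 ∩ B s.2) ≤ ENNReal.ofReal ((1 / 200 * (1 / 2) ^ k) ^ 2) := by
      intro s hs
      have hne : s.1 ≠ s.2 := (Finset.mem_filter.1 hs).2
      have hne' : (3 * a + (s.1.1 : ℕ), 3 * b + (s.1.2 : ℕ)) ≠
          (3 * a + (s.2.1 : ℕ), 3 * b + (s.2.2 : ℕ)) := by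
        intro h
        simp only [Prod.mk.injEq, add_right_inj] at h
        exact hne (Prod.ext (Fin.ext h.1) (Fin.ext h.2))
      rw [hB, measure_blockBad_inter hE hind hne', sq, ENNReal.ofReal_mul (by positivity)]
      exact mul_le_mul' (ih _ _) (ih _ _)
    calc P {ω | ¬ blockGood (siteOpen E M ω) (k + 1) a b}
        ≤ ∑ s ∈ S, P (B s.1 ∩ B s.2) :=
          (measure_mono hsub).trans (measure_biUnion_finset_le _ _)
      _ ≤ S.card • ENNReal.ofReal ((1 / 200 * (1 / 2) ^ k) ^ 2) :=
          Finset.sum_le_card_nsmul _ _ _ hpair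
      _ ≤ 81 • ENNReal.ofReal ((1 / 200 * (1 / 2) ^ k) ^ 2) := nsmul_le_nsmul_left zero_le hcard
      _ = ENNReal.ofReal (81 • (1 / 200 * (1 / 2) ^ k) ^ 2) := ENNReal.ofReal_nsmul.symm
      _ ≤ ENNReal.ofReal (1 / 200 * (1 / 2) ^ (k + 1)) := by
        refine ENNReal.ofReal_le_ofReal ?_
        have h1 : ((1 : ℝ) / 2) ^ k ≤ 1 := pow_le_one₀ (by norm_num) (by norm_num)
        have h2 : (0 : ℝ) < (1 / 2) ^ k := by positivity
        have h3 : ((1 : ℝ) / 2) ^ k * (1 / 2) ^ k ≤ (1 / 2) ^ k := mul_le_of_le_one_right h2.le h1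
        rw [pow_succ ((1 : ℝ) / 2), sq, nsmul_eq_mul]
        push_cast
        linarith

theorem measure_forall_blockGood_pos [IsProbabilityMeasure P] (hE : ∀ c, MeasurableSet (E c))
    (hind : iIndepSet E P)
    (h0 : ∀ a b, P {ω | ¬ siteOpen E M ω a b} ≤ ENNReal.ofReal (1 / 200)) :
    0 < P {ω | ∀ k, blockGood (siteOpen E M ω) k 0 0} := by
  rw [pos_iff_ne_zero]
  intro hzero
  have hbad : P (⋃ k, {ω | ¬ blockGood (siteOpen E M ω) k 0 0}) ≤ ENNReal.ofReal (1 / 100) := by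
    have hs : Summable fun k : ℕ => (1 / 200 * (1 / 2) ^ k : ℝ) :=
      summable_geometric_two.mul_left _
    calc _ ≤ ∑' k, P {ω | ¬ blockGood (siteOpen E M ω) k 0 0} := measure_iUnion_le _
      _ ≤ ∑' k : ℕ, ENNReal.ofReal (1 / 200 * (1 / 2) ^ k) :=
        ENNReal.tsum_le_tsum fun k => measure_blockBad_le hE hind h0 k 0 0
      _ = ENNReal.ofReal (∑' k : ℕ, (1 / 200 * (1 / 2) ^ k)) :=
        (ENNReal.ofReal_tsum_of_nonneg (fun _ => by positivity) hs).symm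
      _ = ENNReal.ofReal (1 / 100) := by
        rw [tsum_mul_left, tsum_geometric_two]; norm_num
  have huniv : (Set.univ : Set Ω) ⊆ {ω | ∀ k, blockGood (siteOpen E M ω) k 0 0} ∪
      ⋃ k, {ω | ¬ blockGood (siteOpen E M ω) k 0 0} := by
    intro ω _
    by_cases h : ∀ k, blockGood (siteOpen E M ω) k 0 0
    · exact Or.inl h
    · exact Or.inr (by simpa using h)
  have h1 : (1 : ℝ≥0∞) ≤ ENNReal.ofReal (1 / 100) := by
    calc (1 : ℝ≥0∞) = P Set.univ := measure_univ.symm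
      _ ≤ _ := (measure_mono huniv).trans (measure_union_le _ _)
      _ ≤ _ := by rw [hzero, zero_add]; exact hbad
  rw [ENNReal.one_le_ofReal] at h1
  norm_num at h1

end Probability

/-! ### Geometry of cubes and cells -/

section Box

variable {d : ℕ}

/-- The half-open cube of side `w` with lower corner `a`. -/
def cube (a : Fin d → ℝ) (w : ℝ) : Set (EuclideanSpace ℝ (Fin d)) :=
  {x | ∀ i, x i ∈ Set.Ico (a i) (a i + w)}

theorem cube_eq_preimage (a : Fin d → ℝ) (w : ℝ) :
    cube a w = WithLp.ofLp ⁻¹' Set.univ.pi fun i => Set.Ico (a i) (a i + w) := by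
  ext x; simp [cube]

theorem measurableSet_pi_Ico (a : Fin d → ℝ) (w : ℝ) :
    MeasurableSet (Set.univ.pi fun i => Set.Ico (a i) (a i + w)) :=
  MeasurableSet.univ_pi fun _ => measurableSet_Ico

theorem measurableSet_cube (a : Fin d → ℝ) (w : ℝ) : MeasurableSet (cube a w) := by
  rw [cube_eq_preimage]
  exact (PiLp.volume_preserving_ofLp (Fin d)).measurable (measurableSet_pi_Ico a w)

theorem volume_cube (a : Fin d → ℝ) (w : ℝ) : volume (cube a w) = ENNReal.ofReal w ^ d := by
  rw [cube_eq_preimage, (PiLp.volume_preserving_ofLp (Fin d)).measure_preimage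
    (measurableSet_pi_Ico a w).nullMeasurableSet, volume_pi_pi]
  simp

theorem dist_le_of_forall_abs_sub_le {x y : EuclideanSpace ℝ (Fin d)} {m : ℝ} (hm : 0 ≤ m)
    (h : ∀ i, |x i - y i| ≤ m) : dist x y ≤ d * m := by
  rw [EuclideanSpace.dist_eq, Real.sqrt_le_iff]
  refine ⟨by positivity, ?_⟩
  calc ∑ i, dist (x i) (y i) ^ 2 ≤ ∑ _i : Fin d, m ^ 2 :=
        Finset.sum_le_sum fun i _ => pow_le_pow_left₀ dist_nonneg (h i) 2
    _ = d * m ^ 2 := by simp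
    _ ≤ (d * d : ℕ) * m ^ 2 :=
        mul_le_mul_of_nonneg_right (Nat.cast_le.2 (Nat.le_mul_self d)) (sq_nonneg m)
    _ = (d * m) ^ 2 := by push_cast; ring

theorem abs_sub_le_dist (x y : EuclideanSpace ℝ (Fin d)) (i : Fin d) :
    |x i - y i| ≤ dist x y := by
  rw [dist_eq_norm]
  exact PiLp.norm_apply_le (x - y) i

theorem isBounded_cube (a : Fin d → ℝ) {w : ℝ} (hw : 0 ≤ w) : Bornology.IsBounded (cube a w) := by
  refine Metric.isBounded_iff.2 ⟨d * w, fun x hx y hy => dist_le_of_forall_abs_sub_le hw fun i => ?_⟩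
  have h1 := hx i
  have h2 := hy i
  rw [abs_le]
  constructor <;> linarith [h1.1, h1.2, h2.1, h2.2]

/-- The coordinates of the planar cell with index `c`, in units of the side of a cell. -/
def cellIndex (c : ℕ × ℕ) (i : Fin d) : ℕ :=
  if i.val = 0 then c.1 else if i.val = 1 then c.2 else 0

/-- The cell of side `3 ℓ` with index `c`. -/
def cell (d : ℕ) (ℓ : ℝ) (c : ℕ × ℕ) : Set (EuclideanSpace ℝ (Fin d)) :=
  cube (fun i => 3 * ℓ * cellIndex c i) (3 * ℓ)

/-- The cube of side `ℓ` in the centre of the cell with index `c`. -/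
def cellCentre (d : ℕ) (ℓ : ℝ) (c : ℕ × ℕ) : Set (EuclideanSpace ℝ (Fin d)) :=
  cube (fun i => 3 * ℓ * cellIndex c i + ℓ) ℓ

variable {ℓ : ℝ}

theorem cellCentre_subset_cell (hℓ : 0 < ℓ) (c : ℕ × ℕ) : cellCentre d ℓ c ⊆ cell d ℓ c := by
  intro x hx i
  have := hx i
  constructor <;> linarith [this.1, this.2]

/-- Recovering the index from a point gives disjointness of cells, and later the unboundedness of
the cluster. -/
theorem floor_eq_of_mem_cell (hℓ : 0 < ℓ) {c : ℕ × ℕ} {x : EuclideanSpace ℝ (Fin d)}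
    (hx : x ∈ cell d ℓ c) (i : Fin d) : ⌊x i / (3 * ℓ)⌋₊ = cellIndex c i := by
  have h := hx i
  have h3 : 0 < 3 * ℓ := by positivity
  rw [Nat.floor_eq_iff (div_nonneg ((by positivity : (0 : ℝ) ≤ 3 * ℓ * cellIndex c i).trans h.1)
    h3.le), le_div_iff₀ h3, div_lt_iff₀ h3]
  constructor <;> linarith [h.1, h.2]

theorem disjoint_cell (hd : 2 ≤ d) (hℓ : 0 < ℓ) {c c' : ℕ × ℕ} (h : c ≠ c') :
    Disjoint (cell d ℓ c) (cell d ℓ c') := by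
  refine Set.disjoint_left.2 fun x hx hx' => h ?_
  have key : ∀ i : Fin d, cellIndex c i = cellIndex c' i := fun i =>
    (floor_eq_of_mem_cell hℓ hx i).symm.trans (floor_eq_of_mem_cell hℓ hx' i)
  exact Prod.ext (by simpa [cellIndex] using key ⟨0, by omega⟩)
    (by simpa [cellIndex] using key ⟨1, by omega⟩)

theorem le_dist_of_mem_cellCentre_of_notMem_cell {c : ℕ × ℕ}
    {x y : EuclideanSpace ℝ (Fin d)} (hx : x ∈ cellCentre d ℓ c) (hy : y ∉ cell d ℓ c) :
    ℓ ≤ dist x y := by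
  simp only [cell, cube, Set.mem_ofPred_eq, not_forall] at hy
  obtain ⟨i, hi⟩ := hy
  have h := hx i
  refine le_trans ?_ (abs_sub_le_dist x y i)
  rw [Set.mem_Ico, not_and_or, not_le, not_lt] at hi
  rcases hi with hi | hi
  · exact le_trans (by linarith [h.1]) (le_abs_self _)
  · exact le_trans (by linarith [h.2]) (neg_le_abs _)

theorem abs_sub_le_of_mem_cell (hℓ : 0 < ℓ) {c c' : ℕ × ℕ} {n : ℕ}
    (h1 : c.1 ≤ c'.1 + n) (h1' : c'.1 ≤ c.1 + n) (h2 : c.2 ≤ c'.2 + n) (h2' : c'.2 ≤ c.2 + n)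
    {x y : EuclideanSpace ℝ (Fin d)} (hx : x ∈ cell d ℓ c) (hy : y ∈ cell d ℓ c') (i : Fin d) :
    |x i - y i| ≤ 3 * ℓ * (n + 1) := by
  have hi : cellIndex c i ≤ cellIndex c' i + n ∧ cellIndex c' i ≤ cellIndex c i + n := by
    unfold cellIndex
    split_ifs <;> omega
  have e1 : (cellIndex c i : ℝ) ≤ cellIndex c' i + n := by exact_mod_cast hi.1
  have e2 : (cellIndex c' i : ℝ) ≤ cellIndex c i + n := by exact_mod_cast hi.2
  have f1 := mul_le_mul_of_nonneg_left e1 (by positivity : 0 ≤ 3 * ℓ)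
  have f2 := mul_le_mul_of_nonneg_left e2 (by positivity : 0 ≤ 3 * ℓ)
  have h := hx i
  have h' := hy i
  rw [abs_le]
  constructor <;> linarith [h.1, h.2, h'.1, h'.2]

end Box

/-! ### From good blocks to an infinite component -/

section Graph

variable {d : ℕ} {S : Set (EuclideanSpace ℝ (Fin d))}

theorem gnOneGraph_reachable {α : ℝ≥0} {r : ℝ} {x y : S}
    (hx : ∀ z ∈ S, z ≠ x → r ≤ dist (x : EuclideanSpace ℝ (Fin d)) z)
    (hxy : dist (x : EuclideanSpace ℝ (Fin d)) y ≤ α * r) : (gnOneGraph α S).Reachable x y := by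
  by_cases hne : x = y
  · rw [hne]
  -- The point `y` is needed here: `Metric.infDist` to the empty set is `0`, which would break the
  -- lower bound.
  · have hmem : (y : EuclideanSpace ℝ (Fin d)) ∈ S \ {(x : EuclideanSpace ℝ (Fin d))} :=
      ⟨y.2, fun h => hne (Subtype.ext h.symm)⟩
    have hr : r ≤ nnDist S x := (Metric.le_infDist ⟨_, hmem⟩).2 fun z hz => hx z hz.1 hz.2
    refine SimpleGraph.Adj.reachable ((SimpleGraph.fromRel_adj _ _ _).2 ⟨hne, Or.inl ?_⟩)
    exact hxy.trans (mul_le_mul_of_nonneg_left hr α.2)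

theorem percolates_of_forall_blockGood (hd : 2 ≤ d) {ℓ : ℝ} (hℓ : 0 < ℓ) {M : ℕ} (hM : 0 < M)
    {G : ℕ → ℕ → Prop}
    (hG : ∀ a b, G a b → ∃ x ∈ S, (∃ i < M, x ∈ cell d ℓ (M * a + i, b)) ∧
      ∀ z ∈ S, z ≠ x → ℓ ≤ dist x z)
    (h : ∀ k, blockGood G k 0 0) : Percolates ((6 * M * d : ℕ) : ℝ≥0) S := by
  obtain ⟨x₀, hx₀, -⟩ := hG 0 0 (h 0)
  have hG' : ∀ a b, ∃ x : S, G a b →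
      (∃ i < M, (x : EuclideanSpace ℝ (Fin d)) ∈ cell d ℓ (M * a + i, b)) ∧
      ∀ z ∈ S, z ≠ x → ℓ ≤ dist (x : EuclideanSpace ℝ (Fin d)) z := by
    intro a b
    by_cases hab : G a b
    · obtain ⟨x, hx, h⟩ := hG a b hab
      exact ⟨⟨x, hx⟩, fun _ => h⟩
    · exact ⟨⟨x₀, hx₀⟩, fun h => absurd h hab⟩
  choose f hf using hG'
  have hlink : ∀ a b a' b', a ≤ a' → a' ≤ a + 1 → b ≤ b' → b' ≤ b + 1 → G a b → G a' b' →
      (gnOneGraph ((6 * M * d : ℕ) : ℝ≥0) S).Reachable (f a b) (f a' b') := by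
    intro a b a' b' h1 h2 h3 h4 hg hg'
    obtain ⟨⟨i, hi, hxi⟩, hlone⟩ := hf a b hg
    obtain ⟨⟨j, hj, hyj⟩, -⟩ := hf a' b' hg'
    refine gnOneGraph_reachable hlone ?_
    have m1 : M * a ≤ M * a' := Nat.mul_le_mul_left M h1
    have m2 : M * a' ≤ M * a + M := (Nat.mul_le_mul_left M h2).trans (by rw [mul_add, mul_one])
    -- Cells of adjacent sites differ by at most `2 M - 1` in index, so coordinates differ by at
    -- most `6 M ℓ`; the factor `d` bounds the Euclidean distance.
    have hb := dist_le_of_forall_abs_sub_le (by positivity)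
      (abs_sub_le_of_mem_cell hℓ (n := 2 * M - 1) (by dsimp only; omega) (by dsimp only; omega)
        (by dsimp only; omega) (by dsimp only; omega) hxi hyj)
    refine hb.trans (le_of_eq ?_)
    have : ((2 * M - 1 : ℕ) : ℝ) + 1 = 2 * M := by
      exact_mod_cast Nat.sub_add_cancel (by omega : 1 ≤ 2 * M)
    rw [this]
    push_cast
    ring
  have hfar := exists_rel_far_of_forall_blockGood
    (SimpleGraph.reachable_is_equivalence (gnOneGraph ((6 * M * d : ℕ) : ℝ≥0) S))
    (fun a b => hlink a b (a + 1) b (by omega) (by omega) (by omega) (by omega))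
    (fun a b => hlink a b a (b + 1) (by omega) (by omega) (by omega) (by omega)) h
  refine ⟨(gnOneGraph _ S).connectedComponentMk (f 0 0), fun hfin => ?_⟩
  set g : S → ℕ := fun x => ⌊(x : EuclideanSpace ℝ (Fin d)) ⟨0, by omega⟩ / (3 * ℓ)⌋₊
  obtain ⟨m, hm⟩ := (hfin.image g).bddAbove
  obtain ⟨a, b, ha, hab, hreach⟩ := hfar (m + 1)
  obtain ⟨⟨i, hi, hxi⟩, -⟩ := hf a b hab
  have h1 : g (f a b) ≤ m := hm ⟨f a b, by
    rw [SimpleGraph.ConnectedComponent.mem_supp_iff, SimpleGraph.ConnectedComponent.eq]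
    exact hreach.symm, rfl⟩
  have h2 : g (f a b) = M * a + i := by
    simpa [cellIndex] using floor_eq_of_mem_cell hℓ hxi ⟨0, by omega⟩
  have h3 : a ≤ M * a := Nat.le_mul_of_pos_left a hM
  omega

end Graph

/-! ### Lonely cells of the Poisson process -/

section Poisson

theorem iIndepFun_of_forall_fin {Ω ι β : Type*} [MeasurableSpace Ω] [MeasurableSpace β]
    {P : Measure Ω} {f : ι → Ω → β}
    (h : ∀ (n : ℕ) (e : Fin n → ι), Function.Injective e → iIndepFun (fun i => f (e i)) P) :
    iIndepFun f P := by
  rw [iIndepFun_iff_measure_inter_preimage_eq_mul]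
  intro S A hA
  set e : Fin S.card → ι := fun j => S.equivFin.symm j with he
  have hinj : Function.Injective e := Subtype.val_injective.comp S.equivFin.symm.injective
  have hS : S = Finset.univ.map ⟨e, hinj⟩ := by
    ext i
    simp only [Finset.mem_map, Finset.mem_univ, true_and, Function.Embedding.coeFn_mk]
    constructor
    · intro hi
      exact ⟨S.equivFin ⟨i, hi⟩, by simp [he]⟩
    · rintro ⟨j, rfl⟩
      exact (S.equivFin.symm j).2
  have key := (h _ e hinj).measure_inter_preimage_eq_mul Finset.univ (sets := fun j => A (e j))
    (fun j _ => hA _ (S.equivFin.symm j).2)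
  rw [hS, Finset.prod_map]
  simpa using key

variable {Ω : Type*} [MeasurableSpace Ω] {P : Measure Ω} {d : ℕ} {ρ : ℝ≥0}
  {X : Ω → Set (EuclideanSpace ℝ (Fin d))}

theorem IsPoissonProcess.iIndepFun_count (hX : IsPoissonProcess P ρ X) {ι : Type*}
    {B : ι → Set (EuclideanSpace ℝ (Fin d))} (hB : ∀ i, MeasurableSet (B i))
    (hb : ∀ i, Bornology.IsBounded (B i)) (hdisj : Pairwise (Function.onFun Disjoint B)) :
    iIndepFun (fun i ω => (X ω ∩ B i).ncard) P :=
  iIndepFun_of_forall_fin fun n e he => hX.indep_count n (fun j => B (e j)) (fun _ => hB _)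
    (fun _ => hb _) fun _ _ hij => hdisj (he.ne hij)

theorem IsPoissonProcess.measure_count_eq (hX : IsPoissonProcess P ρ X)
    {B : Set (EuclideanSpace ℝ (Fin d))} (hB : MeasurableSet B) (hb : Bornology.IsBounded B)
    (n : ℕ) : P {ω | (X ω ∩ B).ncard = n} = poissonMeasure (ρ * (volume B).toNNReal) {n} := by
  rw [← hX.law_count B hB hb, Measure.map_apply (hX.measurable_count B hB hb)
    (measurableSet_singleton n)]
  rfl

/-- The centre of a cell (`true`) and the rest of the cell (`false`). -/
def cellPiece (d : ℕ) (ℓ : ℝ) (t : (ℕ × ℕ) × Bool) : Set (EuclideanSpace ℝ (Fin d)) :=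
  if t.2 then cellCentre d ℓ t.1 else cell d ℓ t.1 \ cellCentre d ℓ t.1

theorem cellPiece_subset_cell {ℓ : ℝ} (hℓ : 0 < ℓ) (t : (ℕ × ℕ) × Bool) :
    cellPiece d ℓ t ⊆ cell d ℓ t.1 := by
  unfold cellPiece
  split_ifs
  · exact cellCentre_subset_cell hℓ _
  · exact Set.sdiff_subset

theorem measurableSet_cellPiece (ℓ : ℝ) (t : (ℕ × ℕ) × Bool) :
    MeasurableSet (cellPiece d ℓ t) := by
  unfold cellPiece
  split_ifs
  · exact measurableSet_cube _ _
  · exact (measurableSet_cube _ _).diff (measurableSet_cube _ _)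

theorem isBounded_cellPiece {ℓ : ℝ} (hℓ : 0 < ℓ) (t : (ℕ × ℕ) × Bool) :
    Bornology.IsBounded (cellPiece d ℓ t) :=
  (isBounded_cube _ (by positivity)).subset (cellPiece_subset_cell hℓ t)

theorem pairwise_disjoint_cellPiece (hd : 2 ≤ d) {ℓ : ℝ} (hℓ : 0 < ℓ) :
    Pairwise (Function.onFun Disjoint (cellPiece d ℓ)) := by
  rintro ⟨c, s⟩ ⟨c', s'⟩ hne
  by_cases hc : c = c'
  · subst hc
    have hs : s ≠ s' := fun h => hne (by rw [h])
    cases s <;> cases s' <;> simp_all [Function.onFun, cellPiece]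
    · exact Set.disjoint_sdiff_left
    · exact Set.disjoint_sdiff_right
  · exact (disjoint_cell hd hℓ hc).mono (cellPiece_subset_cell hℓ _) (cellPiece_subset_cell hℓ _)

/-- The event that a cell contains exactly one point, and that this point lies in its centre. -/
def lonelyEvent (X : Ω → Set (EuclideanSpace ℝ (Fin d))) (ℓ : ℝ) (c : ℕ × ℕ) : Set Ω :=
  {ω | ∀ s : Bool, (X ω ∩ cellPiece d ℓ (c, s)).ncard = s.toNat}

theorem lonelyEvent_eq {Ω : Type*} (X : Ω → Set (EuclideanSpace ℝ (Fin d))) (ℓ : ℝ) (c : ℕ × ℕ) :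
    lonelyEvent X ℓ c = ⋂ s : Bool, (fun ω => (X ω ∩ cellPiece d ℓ (c, s)).ncard) ⁻¹' {s.toNat} := by
  ext ω; simp [lonelyEvent]

theorem exists_lonely_of_mem_lonelyEvent (hX : IsPoissonProcess P ρ X) {ℓ : ℝ} (hℓ : 0 < ℓ)
    {c : ℕ × ℕ} {ω : Ω} (hω : ω ∈ lonelyEvent X ℓ c) :
    ∃ x ∈ X ω, x ∈ cell d ℓ c ∧ ∀ z ∈ X ω, z ≠ x → ℓ ≤ dist x z := by
  obtain ⟨x, hx⟩ := Set.ncard_eq_one.1 (hω true)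
  -- Local finiteness excludes an infinite set, whose `ncard` would also be `0`.
  have h0 := (Set.ncard_eq_zero (hX.locallyFinite ω _ (isBounded_cellPiece hℓ (c, false)))).1
    (hω false)
  have hxm : x ∈ X ω ∩ cellPiece d ℓ (c, true) := by rw [hx]; rfl
  have hxc : x ∈ cellCentre d ℓ c := by simpa [cellPiece] using hxm.2
  refine ⟨x, hxm.1, cellCentre_subset_cell hℓ c hxc, fun z hz hne =>
    le_dist_of_mem_cellCentre_of_notMem_cell hxc fun hzc => ?_⟩
  by_cases hzc' : z ∈ cellCentre d ℓ c
  · have : z ∈ X ω ∩ cellPiece d ℓ (c, true) := ⟨hz, by simpa [cellPiece] using hzc'⟩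
    rw [hx] at this
    exact hne this
  · have : z ∈ X ω ∩ cellPiece d ℓ (c, false) := ⟨hz, by simpa [cellPiece] using ⟨hzc, hzc'⟩⟩
    rw [h0] at this
    exact this

theorem measurableSet_lonelyEvent (hX : IsPoissonProcess P ρ X) {ℓ : ℝ} (hℓ : 0 < ℓ) (c : ℕ × ℕ) :
    MeasurableSet (lonelyEvent X ℓ c) := by
  rw [lonelyEvent_eq]
  exact MeasurableSet.iInter fun s => hX.measurable_count _ (measurableSet_cellPiece ℓ _)
    (isBounded_cellPiece hℓ _) (measurableSet_singleton _)

/-- The pieces of all cells form one disjoint family, so a single factorisation yields both the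
independence of the events and their probability. -/
theorem measure_biInter_lonelyEvent (hX : IsPoissonProcess P ρ X) (hd : 2 ≤ d) {ℓ : ℝ}
    (hℓ : 0 < ℓ) (S : Finset (ℕ × ℕ)) :
    P (⋂ c ∈ S, lonelyEvent X ℓ c) =
      ∏ c ∈ S, ∏ s : Bool, P {ω | (X ω ∩ cellPiece d ℓ (c, s)).ncard = s.toNat} := by
  have hind := hX.iIndepFun_count (measurableSet_cellPiece (d := d) ℓ) (isBounded_cellPiece hℓ)
    (pairwise_disjoint_cellPiece hd hℓ)
  have key := hind.measure_inter_preimage_eq_mul (S ×ˢ Finset.univ)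
    (sets := fun t => {t.2.toNat}) (fun _ _ => measurableSet_singleton _)
  rw [Finset.prod_product] at key
  rw [show (⋂ c ∈ S, lonelyEvent X ℓ c) = ⋂ t ∈ S ×ˢ (Finset.univ : Finset Bool),
    (fun ω => (X ω ∩ cellPiece d ℓ t).ncard) ⁻¹' {t.2.toNat} from ?_]
  · exact key
  · ext ω
    simp only [lonelyEvent, Set.mem_iInter, Set.mem_ofPred_eq, Finset.mem_product, Finset.mem_univ,
      and_true, Set.mem_preimage, Set.mem_singleton_iff]
    exact ⟨fun h t ht => h t.1 ht t.2, fun h c hc s => h (c, s) hc⟩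

theorem measure_lonelyEvent (hX : IsPoissonProcess P ρ X) (hd : 2 ≤ d) {ℓ : ℝ}
    (hℓ : 0 < ℓ) (c : ℕ × ℕ) : P (lonelyEvent X ℓ c) =
      ∏ s : Bool, P {ω | (X ω ∩ cellPiece d ℓ (c, s)).ncard = s.toNat} := by
  simpa only [Finset.mem_singleton, Set.iInter_iInter_eq_left, Finset.prod_singleton] using
    measure_biInter_lonelyEvent hX hd hℓ {c}

theorem iIndepSet_lonelyEvent (hX : IsPoissonProcess P ρ X) (hd : 2 ≤ d) {ℓ : ℝ} (hℓ : 0 < ℓ) :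
    iIndepSet (lonelyEvent X ℓ) P := by
  rw [iIndepSet_iff_meas_biInter (measurableSet_lonelyEvent hX hℓ)]
  intro S
  rw [measure_biInter_lonelyEvent hX hd hℓ]
  exact Finset.prod_congr rfl fun c _ => (measure_lonelyEvent hX hd hℓ c).symm

/-- By the choice of scale the centre has mean 1 and the rest of the cell at most `3 ^ d`, so `ρ`
drops out of the bound. -/
theorem le_measure_lonelyEvent (hX : IsPoissonProcess P ρ X) (hd : 2 ≤ d) {ℓ : ℝ} (hℓ : 0 < ℓ)
    (hρ : ρ * ℓ ^ d = 1) (c : ℕ × ℕ) :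
    ENNReal.ofReal (Real.exp (-1) * Real.exp (-3 ^ d)) ≤ P (lonelyEvent X ℓ c) := by
  have hcount : ∀ s : Bool, P {ω | (X ω ∩ cellPiece d ℓ (c, s)).ncard = s.toNat} =
      poissonMeasure (ρ * (volume (cellPiece d ℓ (c, s))).toNNReal) {s.toNat} := fun s =>
    hX.measure_count_eq (measurableSet_cellPiece ℓ _) (isBounded_cellPiece hℓ _) _
  have hvol : ∀ (a : Fin d → ℝ) (w : ℝ), 0 < w → ((volume (cube a w)).toNNReal : ℝ) = w ^ d := by
    intro a w hw
    rw [volume_cube, ENNReal.coe_toNNReal_eq_toReal, ENNReal.toReal_pow,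
      ENNReal.toReal_ofReal hw.le]
  rw [measure_lonelyEvent hX hd hℓ, Fintype.prod_bool, hcount, hcount,
    poissonMeasure_singleton, poissonMeasure_singleton, ENNReal.ofReal_mul (Real.exp_pos _).le]
  refine mul_le_mul' (ENNReal.ofReal_le_ofReal ?_) (ENNReal.ofReal_le_ofReal ?_)
  · have h1 : ((ρ * (volume (cellPiece d ℓ (c, true))).toNNReal : ℝ≥0) : ℝ) = 1 := by
      rw [NNReal.coe_mul, cellPiece, if_pos rfl, cellCentre, hvol _ _ hℓ, hρ]
    rw [h1]
    simp
  · have h2 : ((volume (cellPiece d ℓ (c, false))).toNNReal : ℝ) ≤ (3 * ℓ) ^ d := by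
      rw [← hvol (fun i => 3 * ℓ * cellIndex c i) _ (by positivity)]
      refine NNReal.coe_le_coe.2 (ENNReal.toNNReal_mono ?_ (measure_mono
        (cellPiece_subset_cell hℓ (c, false))))
      exact (isBounded_cube _ (by positivity)).measure_lt_top.ne
    have h3 : ((ρ * (volume (cellPiece d ℓ (c, false))).toNNReal : ℝ≥0) : ℝ) ≤ 3 ^ d := by
      calc _ ≤ (ρ : ℝ) * (3 * ℓ) ^ d := by
            rw [NNReal.coe_mul]; exact mul_le_mul_of_nonneg_left h2 ρ.2
        _ = 3 ^ d * (ρ * ℓ ^ d) := by rw [mul_pow]; ring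
        _ = 3 ^ d := by rw [hρ, mul_one]
    simpa using h3

end Poisson

/-! ### Choice of constants -/

theorem mainTheorem2 (d : ℕ) (hd : 2 ≤ d) :
    ∃ A : ℝ≥0, ∀ (ρ : ℝ≥0), 0 < ρ →
      ∀ (Ω : Type*) [MeasurableSpace Ω] (P : Measure Ω) [IsProbabilityMeasure P]
        (X : Ω → Set (EuclideanSpace ℝ (Fin d))),
        IsPoissonProcess P ρ X → criticalValue P X ≤ (A : ℝ≥0∞) := by
  set q : ℝ≥0∞ := ENNReal.ofReal (Real.exp (-1) * Real.exp (-3 ^ d)) with hq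
  have hq0 : 0 < q := ENNReal.ofReal_pos.2 (by positivity)
  have hlim := ENNReal.tendsto_pow_atTop_nhds_zero_of_lt_one
    (ENNReal.sub_lt_self ENNReal.one_ne_top one_ne_zero hq0.ne')
  -- `M` is fixed before `ρ` and depends only on `q`, hence only on `d`; this makes the constant
  -- uniform.
  obtain ⟨M, hMq, hM⟩ := ((hlim.eventually_le_const
    (ENNReal.ofReal_pos.2 (by norm_num : (0 : ℝ) < 1 / 200))).and
    (Filter.eventually_gt_atTop 0)).exists
  refine ⟨((6 * M * d : ℕ) : ℝ≥0), fun ρ hρ Ω _ P _ X hX => sInf_le ⟨_, rfl, ?_⟩⟩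
  obtain ⟨ℓ, hℓ, hρℓ⟩ : ∃ ℓ : ℝ, 0 < ℓ ∧ ρ * ℓ ^ d = 1 := by
    have hρ' : (0 : ℝ) < ρ := hρ
    refine ⟨((ρ : ℝ)⁻¹) ^ ((d : ℝ)⁻¹), by positivity, ?_⟩
    rw [Real.rpow_inv_natCast_pow (by positivity) (by omega), mul_inv_cancel₀ hρ'.ne']
  have hE := measurableSet_lonelyEvent hX hℓ
  have hind := iIndepSet_lonelyEvent hX hd hℓ
  refine (measure_forall_blockGood_pos (M := M) hE hind fun a b =>
    (measure_siteClosed_le hE hind (le_measure_lonelyEvent hX hd hℓ hρℓ) a b).trans hMq).trans_le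
    (measure_mono fun ω hω => percolates_of_forall_blockGood hd hℓ hM ?_ hω)
  rintro a b ⟨i, hi, hω⟩
  obtain ⟨x, hx, hxc, hlone⟩ := exists_lonely_of_mem_lonelyEvent hX hℓ hω
  exact ⟨x, hx, ⟨i, hi, hxc⟩, hlone⟩
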